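/- **Setting.** In the Coate–Loury model with two actions, a threshold $\theta\in\Theta=[0,1]$ gives benefit $B_a(\theta)$ to action $a\in\{0,1\}$; action $0$ is free and action $1$ (becoming skilled) costs an agent a random amount $C$ with cdf $F_C$. The agent maximizes benefit minus cost, with ties resolved in favour of action $1$, so $A=1$ if and only if $C\le I(\theta):=B_1(\theta)-B_0(\theta)$. Assume that $\{I(\theta):\theta\in\Theta\}=[0,\omega]$ with $\omega>0$. Consider a sequence of experiments. In each of them $M$ models $\theta_1,\dots,\theta_M$ are deployed, with design points $b_m=I(\theta_m)$, and for each $m$ the actions $A_{m,1},\dots,A_{m,n_m}$ ($n_m\ge1$) of $n_m$ agents are observed. The costs of all the agents in an experiment are i.i.d. with cdf $F_C$ and independent of the design. Put $\widehat\pi(\theta_m)=\frac1{n_m}\sum_{i=1}^{n_m}A_{m,i}$ and $n=\sum_m n_m$, and let $\widehat F_C$ be any minimizer of $$\sum_{m=1}^M n_m\{F(b_m)-\widehat\pi(\theta_m)\}^2$$ over all non-negative, non-decreasing functions $F$. **Assumptions.** * (A1) For some $0\le\alpha<1$ and $K>0$, $|F_C(b)-F_C(b')|\le K|b-b'|^\alpha$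 for all $b,b'\in[0,\omega]$. * (A2) Either, in every experiment, the design points are equidistant over $[0,\omega]$, i.e. $b_m=a+(m-1)h$ with $h>0$, $0\le a\le h$ and $0\le \omega-b_M\le h$ (where $a,h$ may vary with the experiment); or they are i.i.d. from a density on $[0,\omega]$, the same in all the experiments, that is bounded away from zero on $[0,\omega]$. * (A3) Along the sequence of experiments $M\to\infty$, and there are constants $c,c'>0$ such that, for all sufficiently late experiments, $\min_m n_m\ge c\,n/M$ and $\log M\le c'M(\log n/n)^{1/(2\alpha+1)}$. (Both inequalities hold, for instance, if the $n_m$ are uniformly bounded.) **Proposition.** For every constant $\kappa>0$, with $\delta_n=\kappa(\log n/n)^{1/(2\alpha+1)}$, $$\sup_{b\in[\delta_n,\,\omega-\delta_n]}|\widehat F_C(b)-F_C(b)|=O_P\Big(\Big(\frac{\log n}{n}\Big)^{\alpha/(2\alpha+1)}\Big),$$ where a supremum over the empty set is $0$. That is, for every $\varepsilon>0$ there is a constant $K_\varepsilon$ such that, for all sufficiently late experiments, the supremum exceeds $K_\varepsilon(\log n/n)^{\alpha/(2\alpha+1)}$ with (outer) probability at most $\varepsilon$. -/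

import Mathlib

open MeasureTheory ProbabilityTheory Filter Set
open scoped ENNReal

noncomputable section

namespace CoateLoury

/-- Utility of an agent facing the threshold `θ ∈ Θ = [0,1]`: the benefit `B a θ` of the action `a`
minus its cost. Action `0` (staying unskilled) is free, action `1` (becoming skilled) costs `c`. -/
def utility (B : Fin 2 → unitInterval → ℝ) (θ : unitInterval) (c : ℝ) (a : Fin 2) : ℝ :=
  B a θ - (if a = 1 then c else 0)

/-- The utility-maximizing action; a tie is resolved in favour of becoming skilled, so that the
probability of action `1` under `θ` is `F_C (I θ)`. -/
def action (B : Fin 2 → unitInterval → ℝ) (θ : unitInterval) (c : ℝ) : Fin 2 :=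
  if utility B θ c 0 ≤ utility B θ c 1 then 1 else 0

/-- The incentive `I θ` to become skilled. -/
def incentive (B : Fin 2 → unitInterval → ℝ) (θ : unitInterval) : ℝ := B 1 θ - B 0 θ

theorem utility_le_action (B : Fin 2 → unitInterval → ℝ) (θ : unitInterval) (c : ℝ) (a : Fin 2) :
    utility B θ c a ≤ utility B θ c (action B θ c) := by
  unfold action
  split_ifs with h
  · fin_cases a
    · exact h
    · exact le_rfl
  · fin_cases a
    · exact le_rfl
    · exact (not_le.mp h).le

theorem action_eq_one_iff (B : Fin 2 → unitInterval → ℝ) (θ : unitInterval) (c : ℝ) :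
    action B θ c = 1 ↔ c ≤ incentive B θ := by
  unfold action utility incentive
  simp only [ite_eq_left_iff]
  constructor
  · intro h
    by_contra h'
    have := h (by simp; linarith)
    simp at this
  · intro h h'
    exact absurd (by simp; linarith) h'

/-- Observed proportion of agents who chose action `1` in a sample of size `N`. -/
def proportion {N : ℕ} (A : Fin N → Fin 2) : ℝ := (∑ i, ((A i : ℕ) : ℝ)) / N

/-- The class of non-negative, monotonically increasing functions. -/
def monotoneClass : Set (ℝ → ℝ) := {F | Monotone F ∧ ∀ b, 0 ≤ F b}

/-- The weighted least-squares criterion `∑ n_m (F(b_m) - p_m)²`. -/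
def weightedLoss {M : ℕ} (N : Fin M → ℕ) (b p : Fin M → ℝ) (F : ℝ → ℝ) : ℝ :=
  ∑ m, (N m : ℝ) * (F (b m) - p m) ^ 2

/-- `F` is a weighted isotonic least-squares estimate. It is unique only at the design points;
every minimizer over the class is one. -/
def IsIsotonicLSE {M : ℕ} (N : Fin M → ℕ) (b p : Fin M → ℝ) (F : ℝ → ℝ) : Prop :=
  F ∈ monotoneClass ∧ IsMinOn (weightedLoss N b p) monotoneClass F

/-- Equidistant points over `[0,w]`: `b_m = a + m h`, with the first and the last point at
distance at most one step `h` from the ends `0` and `w`. This covers the grids with both, one or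
none of the end points, and the grid of midpoints. -/
def IsEquidistant (w : ℝ) {M : ℕ} (b : Fin M → ℝ) : Prop :=
  ∃ a h : ℝ, 0 < h ∧ 0 ≤ a ∧ a ≤ h ∧
    a + ((M : ℝ) - 1) * h ≤ w ∧ w ≤ a + (M : ℝ) * h ∧
    ∀ m : Fin M, b m = a + ((m : ℕ) : ℝ) * h

/-- Independent points on `[0,w]` with common Lebesgue density `f`. -/
def IsIIDDesign {Ω : Type*} [MeasurableSpace Ω] (μ : Measure Ω) (w : ℝ) (f : ℝ → ℝ≥0∞)
    {M : ℕ} (b : Fin M → Ω → ℝ) : Prop :=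
  iIndepFun b μ ∧ ∀ m, μ.map (b m) = (volume.restrict (Icc 0 w)).withDensity f

/-- `f` is bounded away from zero on `[0,w]`. -/
def BoundedAwayFromZero (w : ℝ) (f : ℝ → ℝ≥0∞) : Prop :=
  ∃ c : ℝ, 0 < c ∧ ∀ᵐ x ∂(volume.restrict (Icc 0 w)), ENNReal.ofReal c ≤ f x

/-- `X_k = O_P(r_k)`. -/
def IsBigOP {Ω : Type*} [MeasurableSpace Ω] (μ : Measure Ω) (X : ℕ → Ω → ℝ≥0∞) (r : ℕ → ℝ) :
    Prop :=
  ∀ ε : ℝ, 0 < ε → ∃ K : ℝ, 0 < K ∧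
    ∀ᶠ k in atTop, μ {x | ENNReal.ofReal (K * r k) < X k x} ≤ ENNReal.ofReal ε

/-- `sup_{b ∈ S} |F b - G b|`, with the value `0` if `S` is empty. -/
def supError (S : Set ℝ) (F G : ℝ → ℝ) : ℝ≥0∞ := ⨆ b ∈ S, ENNReal.ofReal |F b - G b|

/-- The total sample size `n = ∑ n_m`, as a real number. -/
def total {M : ℕ} (N : Fin M → ℕ) : ℝ := ((∑ m, N m : ℕ) : ℝ)

/-- `(log n / n) ^ s`. -/
def logRate (n s : ℝ) : ℝ := (Real.log n / n) ^ s

end CoateLoury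

end

/-! Let `g` be a least-squares solution, `p` the observed proportions, `F` the true cdf. If `g x >
0`, then `g` can be lowered slightly, without leaving the class, at the design points up to `y`
where it is at least `g x`. First-order optimality then makes the weighted sum of `g - p` over these
points non-positive (`IsIsotonicLSE.sum_upper_le`). By monotonicity they form a block of consecutive
design points that contains all those in `[x, y]`. On the block `g ≥ g x` and `F ≤ F y`, so if the
noise averaged over the block is at most `e`, then `g x ≤ F y + e`. Raising `g` gives the matching
lower bound. Moving `y` a distance `d'` from `x` costs a bias `K * d' ^ α`, and the error is at most
this bias plus `e` (`IsIsotonicLSE.abs_sub_le`).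

Two events of probability tending to one make this quantitative. `DenseDesign`: windows with width
of order `δ` contain at least a constant times `M δ` design points, hence, by balance, a constant
times `n δ` observations. `SmallNoise`: by Hoeffding and a union bound over the at most `M² ≤ n²`
pairs of block ends, all blocks of weight at least of order `n δ` have mean noise at most of order
`√(log n / (n δ))`. Bias `δ^α` and noise agree in order at `δ` of order `(log n / n)^(1/(2α+1))`,
which gives the rate. -/

namespace CoateLoury

/-! ### Optimality conditions for isotonic least squares -/

/-- First-order condition at an isotonic least-squares estimate, in a feasible direction `d`. -/
theorem IsIsotonicLSE.directional_nonneg {M : ℕ} {N : Fin M → ℕ} {b p : Fin M → ℝ} {g : ℝ → ℝ}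
    (hg : IsIsotonicLSE N b p g) (d : Fin M → ℝ) {e : ℝ} (he : 0 < e)
    (hd : ∀ t, 0 < t → t ≤ e → ∃ f ∈ monotoneClass, ∀ m, f (b m) = g (b m) + t * d m) :
    0 ≤ ∑ m, (N m : ℝ) * ((g (b m) - p m) * d m) := by
  set D := ∑ m, (N m : ℝ) * ((g (b m) - p m) * d m) with hD
  set Q := ∑ m, (N m : ℝ) * d m ^ 2 with hQ
  have hQ0 : 0 ≤ Q := Finset.sum_nonneg fun m _ => by positivity
  have key : ∀ t, 0 < t → t ≤ e → 0 ≤ 2 * D + t * Q := by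
    intro t ht hte
    obtain ⟨f, hf, hfb⟩ := hd t ht hte
    have h := hg.2 hf
    simp only [Set.mem_ofPred_eq, weightedLoss] at h
    have heq : ∑ m, (N m : ℝ) * (f (b m) - p m) ^ 2
        = ∑ m, (N m : ℝ) * (g (b m) - p m) ^ 2 + t * (2 * D + t * Q) := by
      rw [hD, hQ, Finset.mul_sum, Finset.mul_sum, ← Finset.sum_add_distrib, Finset.mul_sum,
        ← Finset.sum_add_distrib]
      refine Finset.sum_congr rfl fun m _ => ?_
      rw [hfb m]; ring
    rw [heq] at h
    exact nonneg_of_mul_nonneg_right (by linarith) ht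
  by_contra! hneg
  -- With this step `t * Q ≤ -D`, so `2 * D + t * Q ≤ D < 0`. The `+ 1` covers `Q = 0`.
  have ht : 0 < min e (-D / (Q + 1)) := lt_min he (div_pos (by linarith) (by linarith))
  have h1 := key _ ht (min_le_left _ _)
  have h2 : min e (-D / (Q + 1)) * Q ≤ -D := by
    calc _ ≤ -D / (Q + 1) * (Q + 1) :=
          mul_le_mul (min_le_right _ _) (by linarith) hQ0 (ht.le.trans (min_le_right _ _))
      _ = -D := by field_simp
  linarith

/-- Only finitely many values occur, so there is room below `a` for a small shift. Inserting `0`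
keeps the shifted function non-negative. -/
theorem exists_gap_below {M : ℕ} (v : Fin M → ℝ) {a : ℝ} (ha : 0 < a) :
    ∃ a', 0 ≤ a' ∧ a' < a ∧ ∀ m, v m < a → v m ≤ a' := by
  set s : Finset ℝ := insert 0 ((Finset.univ.image v).filter (· < a)) with hs
  have hne : s.Nonempty := ⟨0, by simp [hs]⟩
  refine ⟨s.max' hne, s.le_max' _ (by simp [hs]), ?_, fun m hm => s.le_max' _ (by simp [hs, hm])⟩
  have hmem := s.max'_mem hne
  simp only [hs, Finset.mem_insert, Finset.mem_filter] at hmem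
  rcases hmem with h | h
  · simp only [hs]; rw [h]; exact ha
  · exact h.2

theorem exists_gap_above {M : ℕ} (v : Fin M → ℝ) (a : ℝ) :
    ∃ a', a < a' ∧ ∀ m, a < v m → a' ≤ v m := by
  set s : Finset ℝ := insert (a + 1) ((Finset.univ.image v).filter (a < ·)) with hs
  have hne : s.Nonempty := ⟨a + 1, by simp [hs]⟩
  refine ⟨s.min' hne, ?_, fun m hm => s.min'_le _ (by simp [hs, hm])⟩
  have hmem := s.min'_mem hne
  simp only [hs, Finset.mem_insert, Finset.mem_filter] at hmem
  rcases hmem with h | h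
  · simp only [hs]; rw [h]; linarith
  · exact h.2

theorem IsIsotonicLSE.sum_upper_le {M : ℕ} {N : Fin M → ℕ} {b p : Fin M → ℝ} {g : ℝ → ℝ}
    (hg : IsIsotonicLSE N b p g) {a : ℝ} (ha : 0 < a) (y : ℝ) :
    ∑ m with a ≤ g (b m) ∧ b m ≤ y, (N m : ℝ) * (g (b m) - p m) ≤ 0 := by
  obtain ⟨a', ha0, haa, hgap⟩ := exists_gap_below (fun m => g (b m)) ha
  have h := hg.directional_nonneg (fun m => if a ≤ g (b m) ∧ b m ≤ y then -1 else 0)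
    (e := a - a') (by linarith) ?_
  · rw [Finset.sum_filter]
    have h2 := neg_nonpos.2 h
    rw [← Finset.sum_neg_distrib] at h2
    refine le_of_eq_of_le (Finset.sum_congr rfl fun m _ => ?_) h2
    split_ifs <;> ring
  intro t ht hte
  obtain ⟨hmono, hnn⟩ := hg.1
  -- Values at least `a` drop by `t` and those at most `a'` stay. The clipping at `a'` keeps the
  -- order in between. Lowering only to the left of `y` cannot break monotonicity there.
  refine ⟨fun s => if s ≤ y then min (g s) (max (g s - t) a') else g s, ⟨?_, ?_⟩, ?_⟩
  · intro s s' hss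
    have hgs := hmono hss
    dsimp only
    split_ifs with h1 h2 h2
    · exact min_le_min hgs (max_le_max (by linarith) le_rfl)
    · exact (min_le_left _ _).trans hgs
    · exact absurd (hss.trans h2) h1
    · exact hgs
  · intro s
    dsimp only
    split_ifs
    · exact le_min (hnn s) (ha0.trans (le_max_right _ _))
    · exact hnn s
  · intro m
    dsimp only
    by_cases h1 : b m ≤ y
    · by_cases h2 : a ≤ g (b m)
      · rw [if_pos h1, if_pos ⟨h2, h1⟩, max_eq_left (by linarith), min_eq_right (by linarith)]
        ring
      · have := hgap m (not_le.1 h2)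
        rw [if_pos h1, if_neg (fun h => h2 h.1), min_eq_left (le_max_of_le_right this)]
        ring
    · rw [if_neg h1, if_neg (fun h => h1 h.2)]; ring

theorem IsIsotonicLSE.sum_lower_nonneg {M : ℕ} {N : Fin M → ℕ} {b p : Fin M → ℝ} {g : ℝ → ℝ}
    (hg : IsIsotonicLSE N b p g) (a y : ℝ) :
    0 ≤ ∑ m with g (b m) ≤ a ∧ y ≤ b m, (N m : ℝ) * (g (b m) - p m) := by
  obtain ⟨a', haa, hgap⟩ := exists_gap_above (fun m => g (b m)) a
  have h := hg.directional_nonneg (fun m => if g (b m) ≤ a ∧ y ≤ b m then 1 else 0)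
    (e := a' - a) (by linarith) ?_
  · rw [Finset.sum_filter]
    refine h.trans_eq (Finset.sum_congr rfl fun m _ => ?_)
    split_ifs <;> ring
  intro t ht hte
  obtain ⟨hmono, hnn⟩ := hg.1
  refine ⟨fun s => if y ≤ s then max (g s) (min (g s + t) a') else g s, ⟨?_, ?_⟩, ?_⟩
  · intro s s' hss
    have hgs := hmono hss
    dsimp only
    split_ifs with h1 h2 h2
    · exact max_le_max hgs (min_le_min (by linarith) le_rfl)
    · exact absurd (h1.trans hss) h2
    · exact hgs.trans (le_max_left _ _)
    · exact hgs
  · intro s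
    dsimp only
    split_ifs
    · exact (hnn s).trans (le_max_left _ _)
    · exact hnn s
  · intro m
    dsimp only
    by_cases h1 : y ≤ b m
    · by_cases h2 : g (b m) ≤ a
      · rw [if_pos h1, if_pos ⟨h2, h1⟩, min_eq_left (by linarith), max_eq_right (by linarith)]
        ring
      · have := hgap m (not_le.1 h2)
        rw [if_pos h1, if_neg (fun h => h2 h.1), max_eq_left (min_le_of_right_le this)]
        ring
    · rw [if_neg h1, if_neg (fun h => h1 h.2)]; ring

/-! ### From small block noise to pointwise bounds -/

/-- On every block of consecutive design points of weight at least `w₀`, the weighted mean of the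
observations is within `e` of the weighted mean of `F`. -/
def SmallNoise {M : ℕ} (N : Fin M → ℕ) (b p : Fin M → ℝ) (F : ℝ → ℝ) (w₀ e : ℝ) : Prop :=
  ∀ i j, w₀ ≤ ∑ m with b i ≤ b m ∧ b m ≤ b j, (N m : ℝ) →
    |∑ m with b i ≤ b m ∧ b m ≤ b j, (N m : ℝ) * (p m - F (b m))|
      ≤ e * ∑ m with b i ≤ b m ∧ b m ≤ b j, (N m : ℝ)

/-- A finite set of indices that is convex for the order of the design is a block. -/
theorem SmallNoise.abs_sum_le {M : ℕ} {N : Fin M → ℕ} {b p : Fin M → ℝ} {F : ℝ → ℝ} {w₀ e : ℝ}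
    (h : SmallNoise N b p F w₀ e) {S : Finset (Fin M)} (hne : S.Nonempty)
    (hconv : ∀ i ∈ S, ∀ j ∈ S, ∀ m, b i ≤ b m → b m ≤ b j → m ∈ S)
    (hS : w₀ ≤ ∑ m ∈ S, (N m : ℝ)) :
    |∑ m ∈ S, (N m : ℝ) * (p m - F (b m))| ≤ e * ∑ m ∈ S, (N m : ℝ) := by
  obtain ⟨i, hi, hi'⟩ := S.exists_min_image b hne
  obtain ⟨j, hj, hj'⟩ := S.exists_max_image b hne
  have : S = Finset.univ.filter (fun m => b i ≤ b m ∧ b m ≤ b j) := by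
    ext m
    simp only [Finset.mem_filter, Finset.mem_univ, true_and]
    exact ⟨fun hm => ⟨hi' m hm, hj' m hm⟩, fun hm => hconv i hi j hj m hm.1 hm.2⟩
  rw [this] at hS ⊢
  exact h i j hS

theorem IsIsotonicLSE.le_of_smallNoise {M : ℕ} {N : Fin M → ℕ} {b p : Fin M → ℝ} {g F : ℝ → ℝ}
    (hg : IsIsotonicLSE N b p g) (hF : Monotone F) (hF0 : ∀ t, 0 ≤ F t) {w₀ e : ℝ} (hw : 0 < w₀)
    (he : 0 ≤ e) (hnoise : SmallNoise N b p F w₀ e) {x y : ℝ}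
    (hxy : w₀ ≤ ∑ m with x ≤ b m ∧ b m ≤ y, (N m : ℝ)) : g x ≤ F y + e := by
  -- At level `0` the function cannot be lowered, but then the bound is trivial.
  rcases (hg.1.2 x).eq_or_lt with h0 | h0
  · rw [← h0]; have := hF0 y; linarith
  -- The optimality condition holds for level sets, not for arbitrary intervals, so the block may
  -- reach to the left of `x`. This is harmless: only `g ≥ g x` and `F ≤ F y` are used on it.
  set S := Finset.univ.filter (fun m => g x ≤ g (b m) ∧ b m ≤ y) with hSdef
  have hmem : ∀ m, m ∈ S ↔ g x ≤ g (b m) ∧ b m ≤ y := by simp [hSdef]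
  have hsub : (∑ m with x ≤ b m ∧ b m ≤ y, (N m : ℝ)) ≤ ∑ m ∈ S, (N m : ℝ) := by
    refine Finset.sum_le_sum_of_subset_of_nonneg ?_ fun _ _ _ => by positivity
    intro m hm
    simp only [Finset.mem_filter, Finset.mem_univ, true_and] at hm
    exact (hmem m).2 ⟨hg.1.1 hm.1, hm.2⟩
  have hS : w₀ ≤ ∑ m ∈ S, (N m : ℝ) := hxy.trans hsub
  have hne : S.Nonempty := by
    by_contra hcon
    rw [Finset.not_nonempty_iff_eq_empty] at hcon
    rw [hcon, Finset.sum_empty] at hS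
    linarith
  have h1 := (abs_le.1 (hnoise.abs_sum_le hne (fun i hi j hj m him hmj => (hmem m).2
    ⟨((hmem i).1 hi).1.trans (hg.1.1 him), hmj.trans ((hmem j).1 hj).2⟩) hS)).2
  have h2 := hg.sum_upper_le h0 y
  have h3 : ∑ m ∈ S, (N m : ℝ) * (g x - F y)
      ≤ ∑ m ∈ S, (N m : ℝ) * (g (b m) - p m) + ∑ m ∈ S, (N m : ℝ) * (p m - F (b m)) := by
    rw [← Finset.sum_add_distrib]
    refine Finset.sum_le_sum fun m hm => ?_
    rw [← mul_add]
    have := hF ((hmem m).1 hm).2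
    exact mul_le_mul_of_nonneg_left (by linarith [((hmem m).1 hm).1]) (by positivity)
  rw [← Finset.sum_mul] at h3
  have h4 : (∑ m ∈ S, (N m : ℝ)) * (g x - F y) ≤ (∑ m ∈ S, (N m : ℝ)) * e := by linarith
  have := le_of_mul_le_mul_left h4 (hw.trans_le hS)
  linarith

theorem IsIsotonicLSE.ge_of_smallNoise {M : ℕ} {N : Fin M → ℕ} {b p : Fin M → ℝ} {g F : ℝ → ℝ}
    (hg : IsIsotonicLSE N b p g) (hF : Monotone F) {w₀ e : ℝ} (hw : 0 < w₀)
    (hnoise : SmallNoise N b p F w₀ e) {x y : ℝ}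
    (hxy : w₀ ≤ ∑ m with y ≤ b m ∧ b m ≤ x, (N m : ℝ)) : F y - e ≤ g x := by
  set S := Finset.univ.filter (fun m => g (b m) ≤ g x ∧ y ≤ b m) with hSdef
  have hmem : ∀ m, m ∈ S ↔ g (b m) ≤ g x ∧ y ≤ b m := by simp [hSdef]
  have hsub : (∑ m with y ≤ b m ∧ b m ≤ x, (N m : ℝ)) ≤ ∑ m ∈ S, (N m : ℝ) := by
    refine Finset.sum_le_sum_of_subset_of_nonneg ?_ fun _ _ _ => by positivity
    intro m hm
    simp only [Finset.mem_filter, Finset.mem_univ, true_and] at hm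
    exact (hmem m).2 ⟨hg.1.1 hm.2, hm.1⟩
  have hS : w₀ ≤ ∑ m ∈ S, (N m : ℝ) := hxy.trans hsub
  have hne : S.Nonempty := by
    by_contra hcon
    rw [Finset.not_nonempty_iff_eq_empty] at hcon
    rw [hcon, Finset.sum_empty] at hS
    linarith
  have h1 := (abs_le.1 (hnoise.abs_sum_le hne (fun i hi j hj m him hmj => (hmem m).2
    ⟨(hg.1.1 hmj).trans ((hmem j).1 hj).1, ((hmem i).1 hi).2.trans him⟩) hS)).1
  have h2 := hg.sum_lower_nonneg (g x) y
  have h3 : ∑ m ∈ S, (N m : ℝ) * (g (b m) - p m) + ∑ m ∈ S, (N m : ℝ) * (p m - F (b m))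
      ≤ ∑ m ∈ S, (N m : ℝ) * (g x - F y) := by
    rw [← Finset.sum_add_distrib]
    refine Finset.sum_le_sum fun m hm => ?_
    rw [← mul_add]
    have := hF ((hmem m).1 hm).2
    exact mul_le_mul_of_nonneg_left (by linarith [((hmem m).1 hm).1]) (by positivity)
  rw [← Finset.sum_mul] at h3
  have h4 : (∑ m ∈ S, (N m : ℝ)) * (-e) ≤ (∑ m ∈ S, (N m : ℝ)) * (g x - F y) := by linarith
  have := le_of_mul_le_mul_left h4 (hw.trans_le hS)
  linarith

/-! ### Concentration of the noise, uniformly over blocks -/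

/-- The centered indicator of `c ≤ t` when `c` has law `ν`. -/
noncomputable def centeredIndicator (ν : Measure ℝ) (t c : ℝ) : ℝ :=
  (if c ≤ t then 1 else 0) - cdf ν t

theorem measurable_centeredIndicator (ν : Measure ℝ) :
    Measurable fun z : ℝ × ℝ => centeredIndicator ν z.1 z.2 := by
  unfold centeredIndicator
  refine Measurable.sub ?_ ((monotone_cdf ν).measurable.comp measurable_fst)
  exact Measurable.ite (measurableSet_le measurable_snd measurable_fst)
    measurable_const measurable_const

/-- Hoeffding's inequality for sums of centered indicators. -/
theorem measure_abs_sum_centeredIndicator {Ω ι : Type*} [MeasurableSpace Ω] {μ : Measure Ω}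
    [IsProbabilityMeasure μ] {ν : Measure ℝ} [IsProbabilityMeasure ν] {C : ι → Ω → ℝ}
    (hCmeas : ∀ q, Measurable (C q)) (hClaw : ∀ q, μ.map (C q) = ν) (hC : iIndepFun C μ)
    (t : ι → ℝ) (s : Finset ι) {e : ℝ} (he : 0 ≤ e) :
    μ {x | e * s.card < |∑ q ∈ s, centeredIndicator ν (t q) (C q x)|}
      ≤ ENNReal.ofReal (2 * Real.exp (-(2 * e ^ 2 * s.card))) := by
  set X : ι → Ω → ℝ := fun q x => centeredIndicator ν (t q) (C q x) with hX
  have hm : ∀ q, Measurable fun c => centeredIndicator ν (t q) c := fun q =>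
    (measurable_centeredIndicator ν).comp (measurable_const.prodMk measurable_id)
  have hind : iIndepFun X μ := hC.comp _ hm
  have hsub : ∀ q, HasSubgaussianMGF (X q) (1 / 4) μ := by
    intro q
    have hmq : Measurable fun x => if C q x ≤ t q then (1 : ℝ) else 0 :=
      Measurable.ite (measurableSet_le (hCmeas q) measurable_const)
        measurable_const measurable_const
    have h := hasSubgaussianMGF_of_mem_Icc (μ := μ) (a := 0) (b := 1) hmq.aemeasurable
      (ae_of_all _ fun x => by split_ifs <;> simp)
    have hint : ∫ x, (if C q x ≤ t q then (1 : ℝ) else 0) ∂μ = cdf ν (t q) := by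
      rw [cdf_eq_real, ← hClaw q, map_measureReal_apply (hCmeas q) measurableSet_Iic,
        ← integral_indicator_one ((hCmeas q) measurableSet_Iic)]
      refine integral_congr_ae (ae_of_all _ fun x => ?_)
      simp [Set.indicator]
    rw [hint] at h
    have h4 : (‖(1 : ℝ) - 0‖₊ / 2) ^ 2 = 1 / 4 := by simp; norm_num
    rwa [h4] at h
  have hneg : iIndepFun (fun q x => - X q x) μ := hind.comp (fun _ z => -z) fun _ => measurable_neg
  have hc : -(e * s.card) ^ 2 / (2 * ∑ q ∈ s, ((1 / 4 : NNReal) : ℝ)) = -(2 * e ^ 2 * s.card) := by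
    rcases s.card.eq_zero_or_pos with h0 | h0
    · simp [h0]
    · have : (s.card : ℝ) ≠ 0 := by positivity
      simp only [Finset.sum_const, nsmul_eq_mul]
      push_cast
      field_simp
      ring
  have h1 := HasSubgaussianMGF.measure_sum_ge_le_of_iIndepFun hind (s := s) (fun q _ => hsub q)
    (ε := e * s.card) (by positivity)
  have h2 := HasSubgaussianMGF.measure_sum_ge_le_of_iIndepFun hneg (s := s) (fun q _ => (hsub q).neg)
    (ε := e * s.card) (by positivity)
  push_cast at h1 h2 hc
  rw [hc] at h1 h2
  have h3 : μ.real {x | e * s.card < |∑ q ∈ s, X q x|}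
      ≤ 2 * Real.exp (-(2 * e ^ 2 * s.card)) := by
    rw [two_mul]
    refine (measureReal_mono ?_).trans ((measureReal_union_le _ _).trans (add_le_add h1 h2))
    intro x hx
    rcases lt_abs.1 (show e * s.card < |∑ q ∈ s, X q x| from hx) with h | h
    · exact Or.inl h.le
    · right
      change _ ≤ ∑ q ∈ s, -X q x
      rw [Finset.sum_neg_distrib]
      exact h.le
  exact (ENNReal.le_ofReal_iff_toReal_le (measure_ne_top _ _) (by positivity)).2 h3

/-- If `X` is independent of `Y`, a bound that holds for every fixed value of `X` holds. -/
theorem measure_prodMk_mem_le {Ω E G : Type*} [MeasurableSpace Ω] [MeasurableSpace E]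
    [MeasurableSpace G] {μ : Measure Ω} [IsProbabilityMeasure μ] {X : Ω → E} {Y : Ω → G}
    (hX : Measurable X) (hY : Measurable Y) (hXY : IndepFun X Y μ) {T : Set (E × G)}
    (hT : MeasurableSet T) {r : ℝ≥0∞} (hr : ∀ x, μ {ω | (x, Y ω) ∈ T} ≤ r) :
    μ {ω | (X ω, Y ω) ∈ T} ≤ r := by
  have := Measure.isProbabilityMeasure_map (μ := μ) hX.aemeasurable
  have := Measure.isProbabilityMeasure_map (μ := μ) hY.aemeasurable
  have h1 : μ {ω | (X ω, Y ω) ∈ T} = μ.map (fun ω => (X ω, Y ω)) T :=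
    (Measure.map_apply (hX.prodMk hY) hT).symm
  rw [h1, (indepFun_iff_map_prod_eq_prod_map_map hX.aemeasurable hY.aemeasurable).1 hXY,
    Measure.prod_apply hT]
  calc _ ≤ ∫⁻ _, r ∂(μ.map X) := by
        refine lintegral_mono fun x => ?_
        rw [Measure.map_apply hY (measurable_prodMk_left hT)]
        exact hr x
    _ = r := by simp

/-- A union bound over the `M ^ 2` pairs of indices delimiting a block. The block may be random, so
the design is first frozen by independence. Hoeffding then applies to a fixed set of agents whose
cardinality is the block weight. -/
theorem measure_not_smallNoise_le {Ω : Type*} [MeasurableSpace Ω] {μ : Measure Ω}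
    [IsProbabilityMeasure μ] {ν : Measure ℝ} [IsProbabilityMeasure ν] {M : ℕ} {N : Fin M → ℕ}
    {b : Fin M → Ω → ℝ} (hb : ∀ m, Measurable (b m))
    {C : (Σ m : Fin M, Fin (N m)) → Ω → ℝ} (hCmeas : ∀ q, Measurable (C q))
    (hClaw : ∀ q, μ.map (C q) = ν) (hC : iIndepFun C μ)
    (hbC : IndepFun (fun x m => b m x) (fun x q => C q x) μ)
    {p : Fin M → Ω → ℝ}
    (hp : ∀ m x, (N m : ℝ) * (p m x - cdf ν (b m x))
      = ∑ i, centeredIndicator ν (b m x) (C ⟨m, i⟩ x))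
    {w₀ e : ℝ} (he : 0 ≤ e) :
    μ {x | ¬ SmallNoise N (fun m => b m x) (fun m => p m x) (cdf ν) w₀ e}
      ≤ ENNReal.ofReal ((M : ℝ) ^ 2 * (2 * Real.exp (-(2 * e ^ 2 * w₀)))) := by
  -- Weight and noise of a block as functions of design and costs, so that the bad event is a
  -- measurable set in a product space.
  set W : Fin M → Fin M → (Fin M → ℝ) → ℝ := fun i j β =>
    ∑ m, if β i ≤ β m ∧ β m ≤ β j then (N m : ℝ) else 0 with hW
  set D : Fin M → Fin M → (Fin M → ℝ) × ((Σ m : Fin M, Fin (N m)) → ℝ) → ℝ := fun i j z =>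
    ∑ m, if z.1 i ≤ z.1 m ∧ z.1 m ≤ z.1 j then
      ∑ l, centeredIndicator ν (z.1 m) (z.2 ⟨m, l⟩) else 0 with hD
  set T : Fin M → Fin M → Set ((Fin M → ℝ) × ((Σ m : Fin M, Fin (N m)) → ℝ)) := fun i j =>
    {z | w₀ ≤ W i j z.1 ∧ e * W i j z.1 < |D i j z|} with hTdef
  have hset : ∀ i j m : Fin M, MeasurableSet {β : Fin M → ℝ | β i ≤ β m ∧ β m ≤ β j} :=
    fun i j m => (measurableSet_le (measurable_pi_apply i) (measurable_pi_apply m)).inter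
      (measurableSet_le (measurable_pi_apply m) (measurable_pi_apply j))
  have hWm : ∀ i j, Measurable (W i j) := fun i j =>
    Finset.measurable_sum _ fun m _ => Measurable.ite (hset i j m) measurable_const measurable_const
  have hDm : ∀ i j, Measurable (D i j) := by
    intro i j
    refine Finset.measurable_sum _ fun m _ => Measurable.ite (measurable_fst (hset i j m)) ?_
      measurable_const
    refine Finset.measurable_sum _ fun l _ => ?_
    have hpair : Measurable fun z : (Fin M → ℝ) × ((Σ m : Fin M, Fin (N m)) → ℝ) =>
        (z.1 m, z.2 ⟨m, l⟩) := by fun_prop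
    exact (measurable_centeredIndicator ν).comp hpair
  have hTm : ∀ i j, MeasurableSet (T i j) := fun i j =>
    (measurableSet_le measurable_const ((hWm i j).comp measurable_fst)).inter
      (measurableSet_lt (((hWm i j).comp measurable_fst).const_mul e) (hDm i j).abs)
  have hbound : ∀ i j, μ {x | ((fun m => b m x), (fun q => C q x)) ∈ T i j}
      ≤ ENNReal.ofReal (2 * Real.exp (-(2 * e ^ 2 * w₀))) := by
    intro i j
    refine measure_prodMk_mem_le (X := fun x m => b m x) (Y := fun x q => C q x)
      (measurable_pi_lambda _ hb) (measurable_pi_lambda _ hCmeas)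
      hbC (hTm i j) fun β => ?_
    set s : Finset (Σ m : Fin M, Fin (N m)) :=
      (Finset.univ.filter fun m => β i ≤ β m ∧ β m ≤ β j).sigma fun _ => Finset.univ with hs
    have hcard : (s.card : ℝ) = W i j β := by
      simp [hs, hW, Finset.card_sigma, Finset.sum_filter]
    by_cases hw : w₀ ≤ W i j β
    · refine (measure_mono ?_).trans
        ((measure_abs_sum_centeredIndicator hCmeas hClaw hC (fun q => β q.1) s he).trans ?_)
      · intro x hx
        have h2 := hx.2
        simp only [Set.mem_ofPred_eq]
        rw [hcard, hs, Finset.sum_sigma, Finset.sum_filter]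
        exact h2
      · refine ENNReal.ofReal_le_ofReal ?_
        rw [hcard]
        gcongr
    · have : {x | (β, fun q => C q x) ∈ T i j} = ∅ := by
        ext x
        simp only [Set.mem_ofPred_eq, Set.mem_empty_iff_false, iff_false]
        exact fun h => hw h.1
      rw [this, measure_empty]
      exact zero_le
  have hsub : {x | ¬ SmallNoise N (fun m => b m x) (fun m => p m x) (cdf ν) w₀ e}
      ⊆ ⋃ i, ⋃ j, {x | ((fun m => b m x), (fun q => C q x)) ∈ T i j} := by
    intro x hx
    simp only [SmallNoise, Set.mem_ofPred_eq, not_forall, not_le] at hx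
    obtain ⟨i, j, h1, h2⟩ := hx
    simp only [Set.mem_iUnion]
    refine ⟨i, j, ?_, ?_⟩
    · simpa only [hW, Finset.sum_filter] using h1
    · simp only [hp, Finset.sum_filter] at h2
      exact h2
  refine (measure_mono hsub).trans ((measure_iUnion_le _).trans ?_)
  rw [tsum_fintype]
  calc _ ≤ ∑ _i : Fin M, ∑ _j : Fin M, ENNReal.ofReal (2 * Real.exp (-(2 * e ^ 2 * w₀))) := by
        refine Finset.sum_le_sum fun i _ => (measure_iUnion_le _).trans ?_
        rw [tsum_fintype]
        exact Finset.sum_le_sum fun j _ => hbound i j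
    _ = _ := by
        simp only [Finset.sum_const, Finset.card_univ, Fintype.card_fin, nsmul_eq_mul]
        rw [ENNReal.ofReal_mul (p := (M : ℝ) ^ 2) (by positivity),
          ENNReal.ofReal_pow (by positivity), ENNReal.ofReal_natCast]
        ring

/-! ### Local density of the design -/

/-- The number of design points in `[u,v]`. -/
noncomputable def countIn {M : ℕ} (β : Fin M → ℝ) (u v : ℝ) : ℕ :=
  (Finset.univ.filter fun m => u ≤ β m ∧ β m ≤ v).card

theorem countIn_mono {M : ℕ} (β : Fin M → ℝ) {u v u' v' : ℝ} (hu : u' ≤ u) (hv : v ≤ v') :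
    (countIn β u v : ℝ) ≤ countIn β u' v' := by
  refine Nat.cast_le.2 (Finset.card_le_card fun m hm => ?_)
  simp only [Finset.mem_filter, Finset.mem_univ, true_and] at hm ⊢
  exact ⟨hu.trans hm.1, hm.2.trans hv⟩

/-- Both one-sided neighbourhoods of width `d'` of every point of `[d, w - d]` contain at least
`r` design points. -/
def DenseDesign {M : ℕ} (w d d' r : ℝ) (β : Fin M → ℝ) : Prop :=
  ∀ x ∈ Icc d (w - d), r ≤ countIn β x (min (x + d') w) ∧ r ≤ countIn β (max (x - d') 0) x

/-- A window cut off by an end of `[0, w]` still contains the end interval of width `d`, because `x`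
lies in `[d, w - d]`. Hence the width `d'` is needed only for windows inside. -/
theorem DenseDesign.of_countIn {M : ℕ} {w d d' r : ℝ} {β : Fin M → ℝ} (hd : 0 < d)
    (hin : ∀ u v, 0 ≤ u → v ≤ w → d' ≤ v - u → r ≤ countIn β u v)
    (hl : r ≤ countIn β 0 d) (hr : r ≤ countIn β (w - d) w) : DenseDesign w d d' r β := by
  intro x hx
  constructor
  · rcases le_total (x + d') w with h | h
    · rw [min_eq_left h]
      exact hin _ _ (hd.le.trans hx.1) h (by linarith)
    · rw [min_eq_right h]
      exact hr.trans (countIn_mono β hx.2 le_rfl)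
  · rcases le_total (x - d') 0 with h | h
    · rw [max_eq_right h]
      exact hl.trans (countIn_mono β le_rfl hx.1)
    · rw [max_eq_left h]
      exact hin _ _ h (by linarith [hx.2]) (by linarith)

/-- The step satisfies `h ≤ 2 * w / M`, since `(M - 1) * h ≤ w` and `M ≥ 2`. An interval of length
`ℓ ≥ 4 * h` is shown to contain `⌊ℓ / (2 * h)⌋ ≥ ℓ / (4 * h)` grid points, hence the `8`. -/
theorem IsEquidistant.le_countIn {M : ℕ} {w : ℝ} {β : Fin M → ℝ} (hβ : IsEquidistant w β)
    (hw : 0 < w) (hM : 2 ≤ M) {u v : ℝ} (hu : 0 ≤ u) (hv : v ≤ w) (huv : 8 * w ≤ M * (v - u)) :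
    M * (v - u) / (8 * w) ≤ countIn β u v := by
  obtain ⟨a, h, hh, ha, hah, h1, h2, hb⟩ := hβ
  have hMR : (2 : ℝ) ≤ M := by exact_mod_cast hM
  have hMh : M * h ≤ 2 * w := by nlinarith
  have hlen : 4 * h ≤ v - u := by
    have : (M : ℝ) * (4 * h) ≤ M * (v - u) := by linarith
    exact le_of_mul_le_mul_left this (by linarith)
  set i₀ := ⌈(u - a) / h⌉₊ with hi0
  set q := ⌊(v - u) / (2 * h)⌋₊ with hq
  have hlow : u ≤ a + i₀ * h := by
    have := Nat.le_ceil ((u - a) / h)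
    rw [div_le_iff₀ hh] at this
    linarith
  have hup : a + i₀ * h ≤ u + h := by
    rcases le_total u a with hua | hua
    · have : i₀ = 0 := Nat.ceil_eq_zero.2 (div_nonpos_of_nonpos_of_nonneg (by linarith) hh.le)
      rw [this]; push_cast; linarith
    · have := (Nat.ceil_lt_add_one (div_nonneg (sub_nonneg.2 hua) hh.le)).le
      have h3 := mul_le_mul_of_nonneg_right this hh.le
      rw [add_mul, div_mul_cancel₀ _ hh.ne'] at h3
      linarith
  have hqle : q * h ≤ (v - u) / 2 := by
    have := Nat.floor_le (show 0 ≤ (v - u) / (2 * h) by apply div_nonneg <;> linarith)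
    rw [le_div_iff₀ (by linarith)] at this
    linarith
  have hpos : ∀ j, j < q → a + ((i₀ + j : ℕ) : ℝ) * h ≤ u + (v - u) / 2 := by
    intro j hj
    have : ((j : ℝ) + 1) ≤ q := by exact_mod_cast hj
    have := mul_le_mul_of_nonneg_right this hh.le
    push_cast
    linarith
  -- Staying in the first half of `[u, v]` puts the point strictly below `w ≤ a + M * h`, which
  -- makes its index admissible.
  have hidx : ∀ j, j < q → i₀ + j < M := by
    intro j hj
    have h3 := hpos j hj
    have h4 : ((i₀ + j : ℕ) : ℝ) * h < M * h := by linarith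
    exact_mod_cast lt_of_mul_lt_mul_right h4 hh.le
  have hcard : q ≤ countIn β u v := by
    have := Finset.card_le_card_of_injOn (s := (Finset.univ : Finset (Fin q)))
      (t := Finset.univ.filter fun m => u ≤ β m ∧ β m ≤ v)
      (fun j => (⟨i₀ + j, hidx j j.2⟩ : Fin M)) ?_ ?_
    · simpa [countIn] using this
    · intro j _
      simp only [Finset.coe_filter, Finset.mem_univ, true_and, Set.mem_ofPred_eq, hb]
      refine ⟨?_, (hpos j j.2).trans (by linarith)⟩
      push_cast
      have : 0 ≤ (j : ℝ) * h := by positivity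
      linarith
    · intro j _ j' _ hjj
      simp only [Fin.mk.injEq] at hjj
      exact Fin.ext (by omega)
  have hq2 : (v - u) / (4 * h) ≤ q := by
    have h3 := (Nat.lt_floor_add_one ((v - u) / (2 * h))).le
    have h4 : 1 ≤ (v - u) / (4 * h) := (one_le_div (by linarith)).2 hlen
    have h5 : (v - u) / (2 * h) = 2 * ((v - u) / (4 * h)) := by field_simp; norm_num
    linarith
  have h6 : M * (v - u) / (8 * w) ≤ (v - u) / (4 * h) := by
    rw [div_le_div_iff₀ (by linarith) (by linarith)]
    nlinarith [mul_le_mul_of_nonneg_right hMh (show 0 ≤ v - u by linarith)]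
  have : (q : ℝ) ≤ countIn β u v := by exact_mod_cast hcard
  linarith

theorem IsEquidistant.denseDesign {M : ℕ} {w d : ℝ} {β : Fin M → ℝ} (hβ : IsEquidistant w β)
    (hw : 0 < w) (hM : 2 ≤ M) (hd : 0 < d) (hdw : d ≤ w) (hMd : 8 * w ≤ M * d) :
    DenseDesign w d d (1 / (8 * w) * (M * d)) β := by
  have key : ∀ u v, 0 ≤ u → v ≤ w → d ≤ v - u → 1 / (8 * w) * (M * d) ≤ countIn β u v := by
    intro u v hu hv huv
    have h1 : (M : ℝ) * d ≤ M * (v - u) := by gcongr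
    refine le_trans ?_ (hβ.le_countIn hw hM hu hv (hMd.trans h1))
    rw [one_div_mul_eq_div]
    gcongr
  exact DenseDesign.of_countIn hd key (key _ _ le_rfl hdw (by simp))
    (key _ _ (by linarith) le_rfl (by simp))

/-- A Chernoff bound for the lower tail of the number of points in a set. -/
theorem measure_countIn_lt_le {Ω : Type*} [MeasurableSpace Ω] {μ : Measure Ω}
    [IsProbabilityMeasure μ] {M : ℕ} {b : Fin M → Ω → ℝ} (hb : ∀ m, Measurable (b m))
    (hind : iIndepFun b μ) {u v q : ℝ} (hq : ∀ m, q ≤ μ.real {x | u ≤ b m x ∧ b m x ≤ v})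
    {r : ℝ} (hr : r ≤ M * q / 4) :
    μ {x | (countIn (fun m => b m x) u v : ℝ) < r} ≤ ENNReal.ofReal (Real.exp (-(M * q / 4))) := by
  set Y : Fin M → Ω → ℝ := fun m x => (Icc u v).indicator (fun _ => (1 : ℝ)) (b m x) with hY
  have hYm : ∀ m, Measurable (Y m) := fun m =>
    (measurable_const.indicator measurableSet_Icc).comp (hb m)
  have hYind : iIndepFun Y μ :=
    hind.comp _ fun _ => measurable_const.indicator measurableSet_Icc
  have hY01 : ∀ m x, Y m x = 0 ∨ Y m x = 1 := by
    intro m x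
    simp only [hY, Set.indicator]
    split_ifs <;> simp
  have he : Real.exp (-1) ≤ 1 / 2 := by
    rw [Real.exp_neg, one_div]
    exact inv_anti₀ (by norm_num) (by have := Real.add_one_le_exp 1; linarith)
  -- For an indicator, `exp (-Y)` is affine in `Y`, so the mgf at `-1` is at most `1 - q / 2 ≤ exp
  -- (-(q / 2))`.
  have hmgf : ∀ m, mgf (Y m) μ (-1) ≤ Real.exp (-(q / 2)) := by
    intro m
    have h1 : ∀ x, Real.exp (-1 * Y m x) = 1 - (1 - Real.exp (-1)) * Y m x := by
      intro x
      rcases hY01 m x with h | h <;> simp [h]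
    have h2 : ∫ x, Y m x ∂μ = μ.real {x | u ≤ b m x ∧ b m x ≤ v} := by
      rw [← integral_indicator_one (s := {x | u ≤ b m x ∧ b m x ≤ v})
        ((hb m) (measurableSet_Icc (a := u) (b := v)))]
      rfl
    have hint : Integrable (Y m) μ := Integrable.of_mem_Icc 0 1 (hYm m).aemeasurable
      (ae_of_all _ fun x => by rcases hY01 m x with h | h <;> simp [h])
    have h3 : mgf (Y m) μ (-1)
        = 1 - (1 - Real.exp (-1)) * μ.real {x | u ≤ b m x ∧ b m x ≤ v} := by
      rw [mgf, integral_congr_ae (ae_of_all _ h1),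
        integral_sub (integrable_const _) (hint.const_mul _), integral_const_mul, h2]
      simp
    rw [h3]
    have h4 := Real.add_one_le_exp (-(q / 2))
    have h5 : 0 ≤ μ.real {x | u ≤ b m x ∧ b m x ≤ v} := measureReal_nonneg
    nlinarith [hq m]
  have hsum : ∀ x, (∑ m, Y m) x = countIn (fun m => b m x) u v := by
    intro x
    simp [hY, countIn, Set.indicator, Finset.sum_apply]
  have hint : Integrable (fun x => Real.exp (-1 * (∑ m, Y m) x)) μ := by
    refine Integrable.of_mem_Icc 0 1 (by fun_prop) (ae_of_all _ fun x => ?_)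
    refine ⟨(Real.exp_pos _).le, Real.exp_le_one_iff.2 ?_⟩
    rw [hsum]
    have : (0 : ℝ) ≤ countIn (fun m => b m x) u v := by positivity
    linarith
  have h := measure_le_le_exp_mul_mgf (μ := μ) (X := ∑ m, Y m) (t := -1) (M * q / 4)
    (by norm_num) hint
  rw [hYind.mgf_sum hYm] at h
  have hprod : ∏ m, mgf (Y m) μ (-1) ≤ Real.exp (-(M * q / 2)) := by
    calc _ ≤ ∏ _m : Fin M, Real.exp (-(q / 2)) :=
          Finset.prod_le_prod (fun m _ => mgf_nonneg) fun m _ => hmgf m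
      _ = _ := by
          rw [Finset.prod_const, Finset.card_univ, Fintype.card_fin, ← Real.exp_nat_mul]
          congr 1; ring
  refine (ENNReal.le_ofReal_iff_toReal_le (measure_ne_top _ _) (Real.exp_pos _).le).2 ?_
  calc μ.real {x | (countIn (fun m => b m x) u v : ℝ) < r}
      ≤ μ.real {x | (∑ m, Y m) x ≤ M * q / 4} := by
        refine measureReal_mono fun x hx => ?_
        simp only [Set.mem_ofPred_eq] at hx ⊢
        rw [hsum]
        linarith
    _ ≤ Real.exp (-(-1) * (M * q / 4)) * Real.exp (-(M * q / 2)) :=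
        h.trans (mul_le_mul_of_nonneg_left hprod (Real.exp_pos _).le)
    _ = _ := by rw [← Real.exp_add]; congr 1; ring

theorem IsIIDDesign.mul_le_measureReal {Ω : Type*} [MeasurableSpace Ω] {μ : Measure Ω}
    [IsProbabilityMeasure μ] {w c : ℝ} {f : ℝ → ℝ≥0∞} {M : ℕ} {b : Fin M → Ω → ℝ}
    (hb : ∀ m, Measurable (b m)) (hD : IsIIDDesign μ w f b)
    (hc : 0 < c) (hf : ∀ᵐ x ∂(volume.restrict (Icc 0 w)), ENNReal.ofReal c ≤ f x)
    {u v : ℝ} (hu : 0 ≤ u) (hv : v ≤ w) (m : Fin M) :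
    c * (v - u) ≤ μ.real {x | u ≤ b m x ∧ b m x ≤ v} := by
  rcases le_total v u with huv | huv
  · exact (mul_nonpos_of_nonneg_of_nonpos hc.le (by linarith)).trans measureReal_nonneg
  refine (ENNReal.ofReal_le_iff_le_toReal (measure_ne_top _ _)).1 ?_
  have h1 : μ {x | u ≤ b m x ∧ b m x ≤ v} = μ.map (b m) (Icc u v) :=
    (Measure.map_apply (hb m) measurableSet_Icc).symm
  rw [h1, hD.2 m, withDensity_apply _ measurableSet_Icc,
    Measure.restrict_restrict measurableSet_Icc,
    Set.inter_eq_left.2 (Icc_subset_Icc hu hv)]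
  calc ENNReal.ofReal (c * (v - u)) = ∫⁻ _ in Icc u v, ENNReal.ofReal c := by
        rw [setLIntegral_const, Real.volume_Icc, ENNReal.ofReal_mul hc.le]
    _ ≤ _ := lintegral_mono_ae (ae_restrict_of_ae_restrict_of_subset (Icc_subset_Icc hu hv) hf)

/-- Cut `[0, w]` into `J` cells of width between `d' / 3` and `d' / 2`: every interval of length
`d'` contains a whole cell, and Chernoff applies to each cell. The union over some `w / d'` cells is
why `d'` may have to exceed `d`. The two end intervals need no such room and keep the width `d`
imposed by the range of the supremum. -/
theorem IsIIDDesign.measure_not_denseDesign_le {Ω : Type*} [MeasurableSpace Ω] {μ : Measure Ω}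
    [IsProbabilityMeasure μ] {w c : ℝ} {f : ℝ → ℝ≥0∞} {M : ℕ} {b : Fin M → Ω → ℝ}
    (hb : ∀ m, Measurable (b m)) (hD : IsIIDDesign μ w f b)
    (hc : 0 < c) (hf : ∀ᵐ x ∂(volume.restrict (Icc 0 w)), ENNReal.ofReal c ≤ f x)
    {d d' : ℝ} (hd : 0 < d) (hdd : d ≤ d') (hdw : d' ≤ w) :
    μ {x | ¬ DenseDesign w d d' (c / 12 * (M * d)) (fun m => b m x)}
      ≤ ENNReal.ofReal (3 * w / d' * Real.exp (-(c / 12 * (M * d'))))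
        + 2 * ENNReal.ofReal (Real.exp (-(c / 12 * (M * d)))) := by
  have hd' : 0 < d' := hd.trans_le hdd
  have hw : 0 < w := hd'.trans_le hdw
  set r := c / 12 * (M * d) with hrdef
  set J := ⌈2 * w / d'⌉₊ with hJ
  have hJpos : 0 < J := Nat.ceil_pos.2 (by positivity)
  have hJR : (0 : ℝ) < J := by exact_mod_cast hJpos
  have hJ1 : 2 * w ≤ J * d' := by
    have := Nat.le_ceil (2 * w / d')
    rwa [div_le_iff₀ hd'] at this
  have hJ2 : J ≤ 3 * w / d' := by
    have h1 := (Nat.ceil_lt_add_one (show 0 ≤ 2 * w / d' by positivity)).le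
    have h2 : 1 ≤ w / d' := (one_le_div hd').2 hdw
    have h3 : 3 * w / d' = 2 * w / d' + w / d' := by ring
    linarith
  have hcell : d' / 3 ≤ w / J := by
    rw [le_div_iff₀ hJR]
    rw [le_div_iff₀ hd'] at hJ2
    linarith
  have hcount : ∀ u v l, 0 ≤ u → v ≤ w → v - u = l → d ≤ 3 * l →
      μ {x | (countIn (fun m => b m x) u v : ℝ) < r}
        ≤ ENNReal.ofReal (Real.exp (-(M * (c * l) / 4))) := by
    intro u v l hu hv hl hdl
    refine measure_countIn_lt_le hb hD.1 (q := c * l)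
      (fun m => hl ▸ hD.mul_le_measureReal hb hc hf hu hv m) ?_
    rw [hrdef]
    have : (M : ℝ) * (c * d) ≤ M * (c * (3 * l)) := by gcongr
    linarith
  have hsub : {x | ¬ DenseDesign w d d' r (fun m => b m x)}
      ⊆ (⋃ j : Fin J, {x | (countIn (fun m => b m x) (j * (w / J)) ((j + 1) * (w / J)) : ℝ) < r})
        ∪ ({x | (countIn (fun m => b m x) 0 d : ℝ) < r}
          ∪ {x | (countIn (fun m => b m x) (w - d) w : ℝ) < r}) := by
    intro x hx
    by_contra hcon
    simp only [Set.mem_union, Set.mem_iUnion, Set.mem_ofPred_eq, not_or, not_exists, not_lt]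
      at hcon
    obtain ⟨h1, h2, h3⟩ := hcon
    refine hx (DenseDesign.of_countIn hd (fun u v hu hv huv => ?_) h2 h3)
    have hl : 0 < w / J := by positivity
    have hwJ : J * (w / J) = w := by field_simp
    have h2l : 2 * (w / J) ≤ v - u := by
      have : 2 * (w / J) ≤ d' := by
        rw [← mul_div_assoc, div_le_iff₀ hJR]; linarith
      linarith
    set j := ⌈u / (w / J)⌉₊ with hj
    have hj1 : u ≤ j * (w / J) := by
      have := Nat.le_ceil (u / (w / J))
      rwa [div_le_iff₀ hl] at this
    have hj2 : (j + 1) * (w / J) ≤ v := by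
      have h4 : (j : ℝ) ≤ u / (w / J) + 1 := (Nat.ceil_lt_add_one (div_nonneg hu hl.le)).le
      have h5 := mul_le_mul_of_nonneg_right h4 hl.le
      rw [add_mul, div_mul_cancel₀ _ hl.ne'] at h5
      rw [add_mul]
      linarith
    have hjJ : j < J := by
      have h4 : ((j : ℝ) + 1) * (w / J) ≤ J * (w / J) := by linarith
      have h5 := le_of_mul_le_mul_right h4 hl
      exact_mod_cast h5
    exact (h1 ⟨j, hjJ⟩).trans (countIn_mono _ hj1 hj2)
  refine (measure_mono hsub).trans ((measure_union_le _ _).trans (add_le_add ?_ ?_))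
  · refine (measure_iUnion_le _).trans ?_
    rw [tsum_fintype]
    have hle : ∀ j : Fin J,
        μ {x | (countIn (fun m => b m x) (j * (w / J)) ((j + 1) * (w / J)) : ℝ) < r}
          ≤ ENNReal.ofReal (Real.exp (-(c / 12 * (M * d')))) := by
      intro j
      have hjJ : ((j : ℕ) : ℝ) + 1 ≤ J := by exact_mod_cast j.2
      refine (hcount _ _ (w / J) (by positivity) ?_ (by ring) (by linarith)).trans
        (ENNReal.ofReal_le_ofReal (Real.exp_le_exp.2 ?_))
      · calc ((j : ℕ) + 1 : ℝ) * (w / J) ≤ J * (w / J) := by gcongr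
          _ = w := by field_simp
      · have : (M : ℝ) * (c * (d' / 3)) ≤ M * (c * (w / J)) := by gcongr
        linarith
    refine (Finset.sum_le_sum fun j _ => hle j).trans ?_
    rw [Finset.sum_const, Finset.card_univ, Fintype.card_fin, nsmul_eq_mul,
      ENNReal.ofReal_mul (by positivity)]
    gcongr
    rw [← ENNReal.ofReal_natCast]
    exact ENNReal.ofReal_le_ofReal hJ2
  · refine (measure_union_le _ _).trans ?_
    rw [two_mul]
    have hexp : Real.exp (-(M * (c * d) / 4)) ≤ Real.exp (-(c / 12 * (M * d))) := by
      refine Real.exp_le_exp.2 ?_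
      have : 0 ≤ (M : ℝ) * (c * d) := by positivity
      linarith
    exact add_le_add
      ((hcount 0 d d le_rfl (by linarith) (by ring) (by linarith)).trans
        (ENNReal.ofReal_le_ofReal hexp))
      ((hcount (w - d) w d (by linarith) le_rfl (by ring) (by linarith)).trans
        (ENNReal.ofReal_le_ofReal hexp))

/-! ### Rates and the noise of the observed proportions -/

theorem logRate_pos {n s : ℝ} (hn : 1 < n) : 0 < logRate n s :=
  Real.rpow_pos_of_pos (div_pos (Real.log_pos hn) (by linarith)) _

theorem tendsto_logRate {s : ℝ} (hs : 0 < s) : Tendsto (fun n => logRate n s) atTop (nhds 0) := by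
  have h : Tendsto (fun n : ℝ => Real.log n / n) atTop (nhds 0) :=
    Real.isLittleO_log_id_atTop.tendsto_div_nhds_zero
  simpa [logRate, Real.zero_rpow hs.ne'] using h.rpow_const (p := s) (Or.inr hs.le)

theorem logRate_rpow {n α : ℝ} (hn : 1 < n) :
    logRate n (1 / (2 * α + 1)) ^ α = logRate n (α / (2 * α + 1)) := by
  have h : 0 < Real.log n / n := div_pos (Real.log_pos hn) (by linarith)
  rw [logRate, logRate, ← Real.rpow_mul h.le]
  congr 1; ring

/-- The bias-variance balance that defines the rate. -/
theorem logRate_balance {n α : ℝ} (hn : 1 < n) (hα : 0 ≤ α) :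
    n * logRate n (1 / (2 * α + 1)) * logRate n (α / (2 * α + 1)) ^ 2 = Real.log n := by
  have h : 0 < Real.log n / n := div_pos (Real.log_pos hn) (by linarith)
  have hn0 : n ≠ 0 := by positivity
  have hα1 : 2 * α + 1 ≠ 0 := by positivity
  rw [logRate, logRate, ← Real.rpow_natCast, ← Real.rpow_mul h.le, mul_assoc, ← Real.rpow_add h]
  have : 1 / (2 * α + 1) + α / (2 * α + 1) * ((2 : ℕ) : ℝ) = 1 := by
    push_cast; field_simp; ring
  rw [this, Real.rpow_one]
  field_simp

theorem le_total {M : ℕ} {N : Fin M → ℕ} (hN : ∀ m, 1 ≤ N m) : (M : ℝ) ≤ total N := by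
  unfold total
  have : ∑ _m : Fin M, 1 ≤ ∑ m, N m := Finset.sum_le_sum fun m _ => hN m
  simp only [Finset.sum_const, Finset.card_univ, Fintype.card_fin, smul_eq_mul, mul_one] at this
  exact_mod_cast this

theorem cast_action (B : Fin 2 → unitInterval → ℝ) (θ : unitInterval) (c : ℝ) :
    (((action B θ c : Fin 2) : ℕ) : ℝ) = if c ≤ incentive B θ then 1 else 0 := by
  by_cases h : c ≤ incentive B θ
  · rw [if_pos h, (action_eq_one_iff B θ c).2 h]; simp
  · rw [if_neg h]
    have h0 : action B θ c = 0 := by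
      have := mt (action_eq_one_iff B θ c).1 h
      omega
    rw [h0]; simp

theorem mul_proportion_sub {N : ℕ} (hN : 1 ≤ N) (B : Fin 2 → unitInterval → ℝ) (θ : unitInterval)
    (c : Fin N → ℝ) (ν : Measure ℝ) :
    (N : ℝ) * (proportion (fun i => action B θ (c i)) - cdf ν (incentive B θ))
      = ∑ i, centeredIndicator ν (incentive B θ) (c i) := by
  have hN0 : (N : ℝ) ≠ 0 := by positivity
  simp only [proportion, cast_action, centeredIndicator, Finset.sum_sub_distrib, Finset.sum_const,
    Finset.card_univ, Fintype.card_fin, nsmul_eq_mul]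
  field_simp

/-! ### Asymptotic density of both kinds of design -/

section Design

variable {Ω : Type*} [MeasurableSpace Ω] {μ : Measure Ω} {w : ℝ} {M : ℕ → ℕ}
  {d : ℕ → ℝ}

theorem tendsto_mul_atTop_of_log_le (hM : Tendsto M atTop atTop) {c : ℝ} (hc : 0 < c)
    (hlog : ∀ᶠ k in atTop, Real.log (M k) ≤ c * (M k * d k)) :
    Tendsto (fun k => M k * d k) atTop atTop := by
  have h1 : Tendsto (fun k => Real.log (M k)) atTop atTop :=
    Real.tendsto_log_atTop.comp (tendsto_natCast_atTop_atTop.comp hM)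
  have h2 : Tendsto (fun k => c * (M k * d k)) atTop atTop := tendsto_atTop_mono' _ hlog h1
  exact (tendsto_const_mul_atTop_of_pos hc).1 h2

theorem tendsto_measure_not_denseDesign_equidistant (hw : 0 < w) (hM : Tendsto M atTop atTop)
    (hd : ∀ᶠ k in atTop, 0 < d k) (hd0 : Tendsto d atTop (nhds 0))
    (hMd : Tendsto (fun k => M k * d k) atTop atTop)
    {b : (k : ℕ) → Fin (M k) → Ω → ℝ}
    (hb : ∀ k, ∃ β : Fin (M k) → ℝ, IsEquidistant w β ∧ ∀ m x, b k m x = β m) :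
    Tendsto (fun k => μ {x | ¬ DenseDesign w (d k) (d k) (1 / (8 * w) * (M k * d k))
      (fun m => b k m x)}) atTop (nhds 0) := by
  refine tendsto_const_nhds.congr' ?_
  filter_upwards [hd, hd0.eventually_le_const hw, hM.eventually_ge_atTop 2,
    hMd.eventually_ge_atTop (8 * w)] with k h1 h2 h3 h4
  obtain ⟨β, hβ, hbβ⟩ := hb k
  have : {x : Ω | ¬ DenseDesign w (d k) (d k) (1 / (8 * w) * (M k * d k))
      (fun m => b k m x)} = ∅ := by
    ext x
    simp only [hbβ, Set.mem_ofPred_eq, Set.mem_empty_iff_false, iff_false, not_not]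
    exact hβ.denseDesign hw h3 h1 h2 h4
  rw [this, measure_empty]

/-- The factor `L` is chosen so that a cell of the partition fails with probability at most `1 / M`.
The union over cells then costs at most `3 * w / (M * d)`, which vanishes because `M * d → ∞`. -/
theorem tendsto_measure_not_denseDesign_iid [IsProbabilityMeasure μ] (hw : 0 < w)
    (hM : Tendsto M atTop atTop)   (hd : ∀ᶠ k in atTop, 0 < d k) (hd0 : Tendsto d atTop (nhds 0))
    {c₁ : ℝ} (hc₁ : 0 < c₁) (hlog : ∀ᶠ k in atTop, Real.log (M k) ≤ c₁ * (M k * d k))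
    {b : (k : ℕ) → Fin (M k) → Ω → ℝ} (hb : ∀ k m, Measurable (b k m))
    {f : ℝ → ℝ≥0∞} {c : ℝ} (hc : 0 < c)
    (hf : ∀ᵐ x ∂(volume.restrict (Icc 0 w)), ENNReal.ofReal c ≤ f x)
    (hD : ∀ k, IsIIDDesign μ w f (b k)) :
    Tendsto (fun k => μ {x | ¬ DenseDesign w (d k) (max 1 (12 * c₁ / c) * d k)
      (c / 12 * (M k * d k)) (fun m => b k m x)}) atTop (nhds 0) := by
  set L := max 1 (12 * c₁ / c) with hL
  have hL1 : 1 ≤ L := le_max_left _ _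
  have hMd := tendsto_mul_atTop_of_log_le hM hc₁ hlog
  have hlim : Tendsto (fun k => ENNReal.ofReal (3 * w / (M k * d k))
      + 2 * ENNReal.ofReal (Real.exp (-(c / 12 * (M k * d k))))) atTop (nhds 0) := by
    have h1 : Tendsto (fun k => 3 * w / (M k * d k)) atTop (nhds 0) :=
      tendsto_const_nhds.div_atTop hMd
    have h2 : Tendsto (fun k => Real.exp (-(c / 12 * (M k * d k)))) atTop (nhds 0) :=
      Real.tendsto_exp_neg_atTop_nhds_zero.comp
        ((tendsto_const_mul_atTop_of_pos (by positivity)).2 hMd)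
    have h3 := (ENNReal.tendsto_ofReal h1).add
      (ENNReal.Tendsto.const_mul (a := 2) (ENNReal.tendsto_ofReal h2) (Or.inr (by simp)))
    simpa using h3
  refine tendsto_of_tendsto_of_tendsto_of_le_of_le' tendsto_const_nhds hlim
    (Eventually.of_forall fun _ => zero_le) ?_
  have hLd : Tendsto (fun k => L * d k) atTop (nhds 0) := by simpa using hd0.const_mul L
  filter_upwards [hd, hLd.eventually_le_const hw, hM.eventually_ge_atTop 1, hlog]
    with k hk hkw hMk hlogk
  have hMR : (0 : ℝ) < M k := by exact_mod_cast hMk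
  refine ((hD k).measure_not_denseDesign_le (hb k) hc hf hk (d' := L * d k)
    (le_mul_of_one_le_left hk.le hL1) hkw).trans ?_
  gcongr
  have h1 : Real.log (M k) ≤ c / 12 * (M k * (L * d k)) := by
    have h2 : 12 * c₁ / c ≤ L := le_max_right _ _
    rw [div_le_iff₀ hc] at h2
    have h3 : 0 ≤ M k * d k := by positivity
    have h4 := mul_le_mul_of_nonneg_right h2 h3
    linarith
  have h2 : Real.exp (-(c / 12 * (M k * (L * d k)))) ≤ (M k : ℝ)⁻¹ := by
    rw [Real.exp_neg]
    refine inv_anti₀ hMR ?_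
    calc (M k : ℝ) = Real.exp (Real.log (M k)) := (Real.exp_log hMR).symm
      _ ≤ _ := Real.exp_le_exp.2 h1
  calc 3 * w / (L * d k) * Real.exp (-(c / 12 * (M k * (L * d k))))
      ≤ 3 * w / d k * (M k : ℝ)⁻¹ := by
        gcongr
        exact le_mul_of_one_le_left hk.le hL1
    _ = _ := by field_simp

end Design

/-! ### Deterministic error bound and conclusion -/

theorem supError_le {S : Set ℝ} {F G : ℝ → ℝ} {r : ℝ} (h : ∀ x ∈ S, |F x - G x| ≤ r) :
    supError S F G ≤ ENNReal.ofReal r :=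
  iSup₂_le fun x hx => ENNReal.ofReal_le_ofReal (h x hx)

/-- The deterministic error bound, on a dense design and with small noise. -/
theorem IsIsotonicLSE.abs_sub_le {M : ℕ} {N : Fin M → ℕ} {b p : Fin M → ℝ} {g F : ℝ → ℝ}
    (hg : IsIsotonicLSE N b p g) (hF : Monotone F) (hF0 : ∀ t, 0 ≤ F t)
    {w K α : ℝ} (hα : 0 ≤ α) (hK : 0 ≤ K)
    (hHolder : ∀ s ∈ Icc (0 : ℝ) w, ∀ t ∈ Icc (0 : ℝ) w, |F s - F t| ≤ K * |s - t| ^ α)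
    {c n d d' r w₀ e : ℝ} (hd : 0 < d) (hd' : 0 ≤ d') (hM : 0 < M) (hn : 0 ≤ c * n)
    (hbal : ∀ m, c * n ≤ (M : ℝ) * N m) (hw₀ : 0 < w₀) (he : 0 ≤ e)
    (hr : w₀ * M ≤ c * n * r) (hdense : DenseDesign w d d' r b)
    (hnoise : SmallNoise N b p F w₀ e) {x : ℝ} (hx : x ∈ Icc d (w - d)) :
    |g x - F x| ≤ K * d' ^ α + e := by
  have hMR : (0 : ℝ) < M := by exact_mod_cast hM
  have hx0 : 0 ≤ x := hd.le.trans hx.1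
  have hxw : x ≤ w := by linarith [hx.2]
  -- Each design point carries at least `c * n / M` observations, so `r` of them carry at least
  -- `w₀`.
  have hweight : ∀ u v, r ≤ countIn b u v → w₀ ≤ ∑ m with u ≤ b m ∧ b m ≤ v, (N m : ℝ) := by
    intro u v huv
    have h1 : (countIn b u v : ℝ) * (c * n) ≤ M * ∑ m with u ≤ b m ∧ b m ≤ v, (N m : ℝ) := by
      rw [Finset.mul_sum, countIn, ← nsmul_eq_mul]
      exact Finset.card_nsmul_le_sum _ _ _ fun m _ => hbal m
    have h2 := mul_le_mul_of_nonneg_right huv hn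
    exact le_of_mul_le_mul_left (by linarith) hMR
  have hstep : ∀ y ∈ Icc (0 : ℝ) w, |y - x| ≤ d' → |F y - F x| ≤ K * d' ^ α := fun y hy hyx =>
    (hHolder y hy x ⟨hx0, hxw⟩).trans
      (mul_le_mul_of_nonneg_left (Real.rpow_le_rpow (abs_nonneg _) hyx hα) hK)
  obtain ⟨h1, h2⟩ := hdense x hx
  have hup := hg.le_of_smallNoise hF hF0 hw₀ he hnoise (hweight _ _ h1)
  have hlo := hg.ge_of_smallNoise hF hw₀ hnoise (hweight _ _ h2)
  -- The comparison points are clamped to `[0, w]`, where the Hölder condition holds.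
  have h3 := (abs_le.1 (hstep (min (x + d') w) ⟨le_min (by linarith) (by linarith), min_le_right _ _⟩
    (abs_le.2 ⟨by linarith [le_min (show x ≤ x + d' by linarith) hxw],
      by linarith [min_le_left (x + d') w]⟩))).2
  have h4 := (abs_le.1 (hstep (max (x - d') 0) ⟨le_max_right _ _, max_le (by linarith) (by linarith)⟩
    (abs_le.2 ⟨by linarith [le_max_left (x - d') 0],
      by linarith [max_le (show x - d' ≤ x by linarith) hx0]⟩))).1
  exact abs_le.2 ⟨by linarith, by linarith⟩

end CoateLoury

open CoateLoury in
theorem mainTheorem2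
    {Ω : Type*} [MeasurableSpace Ω] (μ : Measure Ω) [IsProbabilityMeasure μ]
    -- benefits of the two actions; the incentive has range `[0,w]`
    (B : Fin 2 → unitInterval → ℝ) (w : ℝ) (hw : 0 < w)
    (hrange : Set.range (CoateLoury.incentive B) = Icc 0 w)
    -- law of the cost, with an `α`-Hölder cdf
    (ν : Measure ℝ) [IsProbabilityMeasure ν]
    (α : ℝ) (hα0 : 0 ≤ α) (hα1 : α < 1)
    (hHolder : ∃ K : ℝ, 0 < K ∧ ∀ b ∈ Icc (0 : ℝ) w, ∀ b' ∈ Icc (0 : ℝ) w,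
      |cdf ν b - cdf ν b'| ≤ K * |b - b'| ^ α)
    -- experiment `k`: `M k` models, the `m`-th one shown to `N k m` agents
    (M : ℕ → ℕ) (N : (k : ℕ) → Fin (M k) → ℕ)
    (hM : Tendsto M atTop atTop) (hN : ∀ k m, 1 ≤ N k m)
    (hbalanced : ∃ c : ℝ, 0 < c ∧ ∀ᶠ k in atTop, ∀ m,
      c * CoateLoury.total (N k) ≤ (M k : ℝ) * (N k m : ℝ))
    (hresolution : ∃ c : ℝ, 0 < c ∧ ∀ᶠ k in atTop,
      Real.log (M k) ≤
        c * ((M k : ℝ) * CoateLoury.logRate (CoateLoury.total (N k)) (1 / (2 * α + 1))))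
    -- deployed models and their design points `b = I(θ)`
    (θ : (k : ℕ) → Fin (M k) → Ω → unitInterval)
    (b : (k : ℕ) → Fin (M k) → Ω → ℝ)
    (hb : ∀ k m x, b k m x = CoateLoury.incentive B (θ k m x))
    (hbmeas : ∀ k m, Measurable (b k m))
    (hdesign :
      (∀ k, ∃ d : Fin (M k) → ℝ, CoateLoury.IsEquidistant w d ∧ ∀ m x, b k m x = d m) ∨
      (∃ f : ℝ → ℝ≥0∞, Measurable f ∧ CoateLoury.BoundedAwayFromZero w f ∧
        ∀ k, CoateLoury.IsIIDDesign μ w f (b k)))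
    -- i.i.d. costs of the agents, independent of the design
    (C : (k : ℕ) → (Σ m : Fin (M k), Fin (N k m)) → Ω → ℝ)
    (hCmeas : ∀ k p, Measurable (C k p))
    (hClaw : ∀ k p, μ.map (C k p) = ν)
    (hCindep : ∀ k, iIndepFun (C k) μ)
    (hbC : ∀ k, IndepFun (fun x m => b k m x) (fun x p => C k p x) μ)
    -- observed actions and observed proportions
    (A : (k : ℕ) → (m : Fin (M k)) → Fin (N k m) → Ω → Fin 2)
    (hA : ∀ k m i x, A k m i x = CoateLoury.action B (θ k m x) (C k ⟨m, i⟩ x))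
    (p : (k : ℕ) → Fin (M k) → Ω → ℝ)
    (hp : ∀ k m x, p k m x = CoateLoury.proportion (fun i => A k m i x))
    -- any version of the weighted isotonic least-squares estimate
    (Fhat : ℕ → Ω → ℝ → ℝ)
    (hFhat : ∀ k x,
      CoateLoury.IsIsotonicLSE (N k) (fun m => b k m x) (fun m => p k m x) (Fhat k x))
    (κ : ℝ) (hκ : 0 < κ) (δ : ℕ → ℝ)
    (hδ : ∀ k, δ k = κ * CoateLoury.logRate (CoateLoury.total (N k)) (1 / (2 * α + 1))) :
    CoateLoury.IsBigOP μ
      (fun k x => CoateLoury.supError (Icc (δ k) (w - δ k)) (Fhat k x) (fun t => cdf ν t))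
      (fun k => CoateLoury.logRate (CoateLoury.total (N k)) (α / (2 * α + 1))) := by

  obtain ⟨K, hK, hHolder⟩ := hHolder
  obtain ⟨c, hc, hbal⟩ := hbalanced
  obtain ⟨c', hc', hres⟩ := hresolution
  have hs : 0 < 1 / (2 * α + 1) := by positivity
  set n : ℕ → ℝ := fun k => total (N k) with hn
  have hMn : ∀ k, (M k : ℝ) ≤ n k := fun k => CoateLoury.le_total (hN k)
  have hninf : Tendsto n atTop atTop :=
    tendsto_atTop_mono hMn (tendsto_natCast_atTop_atTop.comp hM)
  have hn1 : ∀ᶠ k in atTop, 1 < n k := hninf.eventually_gt_atTop 1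
  have hδeq : δ = fun k => κ * logRate (n k) (1 / (2 * α + 1)) := funext hδ
  have hδpos : ∀ᶠ k in atTop, 0 < δ k := hn1.mono fun k hk => by
    rw [hδ]; exact mul_pos hκ (logRate_pos hk)
  have hδ0 : Tendsto δ atTop (nhds 0) := by
    rw [hδeq]
    simpa using ((tendsto_logRate hs).comp hninf).const_mul κ
  have hlog : ∀ᶠ k in atTop, Real.log (M k) ≤ c' / κ * (M k * δ k) := hres.mono fun k hk => by
    rw [hδ]
    refine hk.trans_eq ?_
    field_simp
  obtain ⟨L, c₀, hL, hc₀, hdense⟩ : ∃ L c₀ : ℝ, 1 ≤ L ∧ 0 < c₀ ∧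
      Tendsto (fun k => μ {x | ¬ DenseDesign w (δ k) (L * δ k) (c₀ * (M k * δ k))
        (fun m => b k m x)}) atTop (nhds 0) := by
    rcases hdesign with hdes | ⟨f, -, ⟨cf, hcf, hf⟩, hdes⟩
    · refine ⟨1, 1 / (8 * w), le_rfl, by positivity, ?_⟩
      simpa only [one_mul] using tendsto_measure_not_denseDesign_equidistant hw hM hδpos hδ0
        (tendsto_mul_atTop_of_log_le hM (div_pos hc' hκ) hlog) hdes
    · exact ⟨_, cf / 12, le_max_left _ _, by positivity,
        tendsto_measure_not_denseDesign_iid hw hM hδpos hδ0 (div_pos hc' hκ) hlog hbmeas hcf hf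
          hdes⟩
  set r : ℕ → ℝ := fun k => logRate (n k) (α / (2 * α + 1)) with hr
  -- Chosen so that the Hoeffding exponent is `4 * log n`: then `n ^ (-4)` absorbs the `M ^ 2 ≤ n ^
  -- 2` blocks.
  set K₁ : ℝ := Real.sqrt (2 / (c * c₀ * κ)) with hK₁
  have hK₁sq : K₁ ^ 2 = 2 / (c * c₀ * κ) := Real.sq_sqrt (by positivity)
  -- The weight of `c₀ * M * δ` design points with `c * n / M` observations each.
  set w₀ : ℕ → ℝ := fun k => c * c₀ * (n k * δ k) with hw₀
  have hnoise : Tendsto (fun k => μ {x | ¬ SmallNoise (N k) (fun m => b k m x)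
      (fun m => p k m x) (cdf ν) (w₀ k) (K₁ * r k)}) atTop (nhds 0) := by
    have hlim : Tendsto (fun k => ENNReal.ofReal (2 / n k)) atTop (nhds 0) := by
      simpa using ENNReal.tendsto_ofReal ((tendsto_const_nhds (x := (2 : ℝ))).div_atTop hninf)
    refine tendsto_of_tendsto_of_tendsto_of_le_of_le' tendsto_const_nhds hlim
      (Eventually.of_forall fun _ => zero_le) ?_
    filter_upwards [hn1] with k hk
    have hrk : 0 < r k := logRate_pos hk
    refine (measure_not_smallNoise_le (hbmeas k) (hCmeas k) (hClaw k) (hCindep k) (hbC k)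
      (fun m x => ?_) (by positivity)).trans (ENNReal.ofReal_le_ofReal ?_)
    · simp only [hp, hA, hb]
      exact mul_proportion_sub (hN k m) B _ _ ν
    · have hbalance := logRate_balance hk hα0
      have hexp : 2 * (K₁ * r k) ^ 2 * w₀ k = 4 * Real.log (n k) := by
        rw [← hbalance, mul_pow, hK₁sq, hw₀, hδeq]
        field_simp
        simp only [hr]
        ring
      have hn0 : 0 < n k := by linarith
      rw [hexp, show -(4 * Real.log (n k)) = ((4 : ℕ) : ℝ) * -Real.log (n k) by push_cast; ring,
        Real.exp_nat_mul, Real.exp_neg, Real.exp_log hn0]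
      calc (M k : ℝ) ^ 2 * (2 * (n k)⁻¹ ^ 4) ≤ n k ^ 2 * (2 * (n k)⁻¹ ^ 4) := by
            gcongr; exact hMn k
        _ = 2 / n k * (n k)⁻¹ := by field_simp
        _ ≤ 2 / n k * 1 := by gcongr; exact inv_le_one_of_one_le₀ hk.le
        _ = 2 / n k := mul_one _
  intro ε hε
  -- Bias plus noise, in units of `r k`. The constant does not depend on `ε`, since the bad events
  -- have vanishing probability.
  refine ⟨K * (L * κ) ^ α + K₁, by positivity, ?_⟩
  have hsum := hdense.add hnoise
  rw [add_zero] at hsum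
  filter_upwards [hsum.eventually_le_const (ENNReal.ofReal_pos.2 hε), hn1, hδpos, hbal,
    hM.eventually_ge_atTop 1] with k hkε hk hδk hbalk hMk
  -- Monotonicity and subadditivity hold for outer measure, so `Fhat` need not be measurable.
  refine le_trans ((measure_mono ?_).trans (measure_union_le _ _)) hkε
  intro x hx
  by_contra hcon
  simp only [Set.mem_union, Set.mem_ofPred_eq, not_or, not_not] at hcon
  have hrk : 0 < r k := logRate_pos hk
  have hn0 : 0 < n k := by linarith
  refine absurd hx (not_lt.2 (supError_le fun t ht => ?_))
  refine ((hFhat k x).abs_sub_le (monotone_cdf ν) (cdf_nonneg ν) hα0 hK.le hHolder hδk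
    (d' := L * δ k) (by positivity) hMk (by positivity) hbalk (w₀ := w₀ k) (by positivity)
    (by positivity) (le_of_eq ?_) hcon.1 hcon.2 ht).trans_eq ?_
  · simp only [hw₀, hn]; ring
  · have h1 : (L * δ k) ^ α = (L * κ) ^ α * r k := by
      rw [hδ, ← mul_assoc, Real.mul_rpow (by positivity) (logRate_pos hk).le, logRate_rpow hk]
    rw [h1]; ring
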